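/- Let $\mathbb L$ be a field. For a matroid $N$ on a finite set $E$ let $N^*$ be its dual, let $\Delta(N)$ be its independence complex, and let $I_{\Delta(N)}\subseteq S=\mathbb L[x_e : e\in E]$ be the Stanley–Reisner ideal of $\Delta(N)$, generated by the monomials $\prod_{e\in U}x_e$ with $U\subseteq E$ dependent in $N$. For a homogeneous ideal $I\neq 0$ of $S$ let $\alpha(I)$ be the least degree of a nonzero homogeneous element of $I$, let $I^{(s)}=\bigcap_{P\in\mathrm{Ass}(S/I)}(I^sS_P\cap S)$ be its $s$-th symbolic power, and let $$\widehat\alpha(I)=\lim_{s\to\infty}\frac{\alpha(I^{(s)})}{s}=\inf_{s\ge1}\frac{\alpha(I^{(s)})}{s}$$ be its Waldschmidt constant. (1) Let $\mathcal C\subseteq\mathbb K^n$ be a linear code of dimension $k\ge1$ over a field $\mathbb K$, and let $M=M(\mathcal C)$ be its matroid: the matroid on $\{1,\dots,n\}$ in which a set is independent if and only if the columns it indexes in a generator matrix of $\mathcal C$ are linearly independent. For $1\le r\le k$ let $d_r(\mathcal C)=\min|\mathrm{Supp}(\mathcal D)|$ over all $r$-dimensional subspaces $\mathcal D\subseteq\mathcal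 C$, where $\mathrm{Supp}(\mathcal D)$ is the set of $i$ such that $c_i\ne0$ for some $c\in\mathcal D$. Then $$\widehat\alpha(I_{\Delta(M^*)})=\min\left\{\frac{d_r(\mathcal C)}{r} : 1\le r\le k\right\}.$$ (2) Let $M$ be a matroid of rank $k$ on a finite set $E$ with $n=|E|$ elements and $n-k\ge1$. For $1\le r\le n-k=\mathrm{rk}(M^*)$ let $d_r(M)$ be the minimum size of a circuit of the elongation of $M$ by rank $r-1$, i.e. of the matroid on $E$ whose independent sets are the $A\subseteq E$ with $|A|-\mathrm{rk}_M(A)\le r-1$. For a flat $F$ of $M^*$ put $\mathrm{crk}_{M^*}(F)=\mathrm{rk}(M^*)-\mathrm{rk}_{M^*}(F)$. Then $$\widehat\alpha(I_{\Delta(M)})=\min\left\{\frac{d_r(M)}{r} : 1\le r\le n-k\right\}=\min\left\{\frac{|E\setminus F|}{\mathrm{crk}_{M^*}(F)} : F \text{ a flat of } M^*,\ F\ne E\right\}.$$ -/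

import Mathlib

open Filter Topology

universe u v w

namespace MatroidWaldschmidt

noncomputable section

section LinearCodes

variable {K : Type*} [Field K]

/-- The support of a subcode `D ⊆ K^n`: the positions at which some codeword of `D` is nonzero. -/
def codeSupport {n : ℕ} (D : Submodule K (Fin n → K)) : Set (Fin n) :=
  {i | ∃ c ∈ D, c i ≠ 0}

/-- The `r`-th generalized Hamming weight `d_r(C)` of a linear code `C ⊆ K^n`: the least support
size of an `r`-dimensional subcode of `C` (meaningful for `1 ≤ r ≤ dim C`). -/
def codeWeight {n : ℕ} (C : Submodule K (Fin n → K)) (r : ℕ) : ℕ :=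
  sInf {m | ∃ D : Submodule K (Fin n → K),
    D ≤ C ∧ Module.finrank K D = r ∧ m = (codeSupport D).ncard}

/-- `G` is a generator matrix of the code `C`: its rows form a basis of `C`. -/
def IsGeneratorMatrix {k n : ℕ} (G : Matrix (Fin k) (Fin n) K)
    (C : Submodule K (Fin n → K)) : Prop :=
  LinearIndependent K G.row ∧ Submodule.span K (Set.range G.row) = C

/-- The matroid on `[n]` of a `k × n` matrix: a set of indices is independent when the columns
with these indices are linearly independent (as a family). -/
def columnMatroid {k n : ℕ} (G : Matrix (Fin k) (Fin n) K) : Matroid (Fin n) :=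
  (IndepMatroid.ofFinite (E := Set.univ) Set.finite_univ (fun J => LinearIndepOn K G.col J)
    (linearIndepOn_empty K G.col)
    (fun _ _ hJ hIJ => hJ.mono hIJ)
    (by
      intro I J hI hJ hlt
      by_contra! hcon
      have hmem : ∀ e ∈ J, G.col e ∈ Submodule.span K (G.col '' I) := by
        intro e he
        by_cases heI : e ∈ I
        · exact Submodule.subset_span ⟨e, heI, rfl⟩
        · by_contra hn
          exact hcon e he heI (hI.insert hn)
      have hcard : ∀ A : Set (Fin n), LinearIndepOn K G.col A →
          Module.finrank K (Submodule.span K (G.col '' A)) = A.ncard := by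
        intro A hA
        classical
        have h := finrank_span_eq_card (R := K) (b := fun i : A => G.col i) hA
        rw [Set.image_eq_range, h, ← Nat.card_eq_fintype_card, Nat.card_coe_set_eq]
      have hle : Submodule.span K (G.col '' J) ≤ Submodule.span K (G.col '' I) := by
        rw [Submodule.span_le]
        rintro _ ⟨e, he, rfl⟩
        exact hmem e he
      have := Submodule.finrank_mono hle
      rw [hcard I hI, hcard J hJ] at this
      omega)
    (fun I _ => Set.subset_univ I)).matroid

end LinearCodes

section Matroids

variable {E : Type*}

/-- The rank `rk_M(A)` as a natural number (used for finite matroids only). -/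
def rk (M : Matroid E) (A : Set E) : ℕ := (M.eRk A).toNat

/-- The corank `crk_M(F) = rk(M) - rk_M(F)`; the subtraction never truncates for finite matroids. -/
def crk (M : Matroid E) (F : Set E) : ℕ := rk M M.E - rk M F

/-- The elongation of a finite matroid `M` by rank `r`: independent are the sets of nullity
`|A| - rk_M(A)` at most `r`. -/
def elongation [Finite E] (M : Matroid E) (r : ℕ) : Matroid E :=
  (IndepMatroid.ofFinite (E := M.E) (Set.toFinite _)
    (fun A => A ⊆ M.E ∧ A.ncard ≤ rk M A + r)
    (by simp)
    (by
      rintro I J ⟨hJE, hJ⟩ hIJ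
      refine ⟨hIJ.trans hJE, ?_⟩
      have h1 : M.eRk J ≤ M.eRk I + (J \ I).encard := by
        have h := M.eRk_union_le_eRk_add_encard I (J \ I)
        rwa [Set.union_sdiff_cancel hIJ] at h
      have hI' : M.eRk I ≠ ⊤ :=
        ((M.eRk_le_encard I).trans_lt (Set.toFinite I).encard_lt_top).ne
      have hJ' : M.eRk J ≠ ⊤ :=
        ((M.eRk_le_encard J).trans_lt (Set.toFinite J).encard_lt_top).ne
      have h2 : rk M J ≤ rk M I + (J \ I).ncard := by
        unfold rk
        rw [← (Set.toFinite (J \ I)).cast_ncard_eq, ← ENat.natCast_toNat hI',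
          ← ENat.natCast_toNat hJ'] at h1
        exact_mod_cast h1
      have h3 := Set.ncard_sdiff_add_ncard_of_subset hIJ (Set.toFinite J)
      omega)
    (by
      rintro I J ⟨hIE, hI⟩ ⟨hJE, hJ⟩ hlt
      by_contra! hcon
      have fin : ∀ A : Set E, M.eRk A ≠ ⊤ := fun A =>
        ((M.eRk_le_encard A).trans_lt (Set.toFinite A).encard_lt_top).ne
      have mono : ∀ A B : Set E, A ⊆ B → rk M A ≤ rk M B := fun A B h =>
        ENat.toNat_le_toNat (M.eRk_mono h) (fin B)
      obtain ⟨e₀, he₀J, he₀I⟩ := Set.exists_mem_notMem_of_ncard_lt_ncard hlt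
      have step : ∀ e ∈ J, e ∉ I → rk M (insert e I) ≤ rk M I ∧ rk M I + r ≤ I.ncard := by
        intro e he heI
        have h := hcon e he heI (Set.insert_subset (hJE he) hIE)
        rw [Set.ncard_insert_of_notMem heI (Set.toFinite I)] at h
        have := mono I (insert e I) (Set.subset_insert e I)
        omega
      have hcl : J ⊆ M.closure I := by
        intro e he
        by_cases heI : e ∈ I
        · exact M.subset_closure I hIE heI
        · by_contra hn
          obtain ⟨B, hB⟩ := M.exists_isBasis I hIE
          have hins : M.Indep (insert e B) := by
            rw [hB.indep.insert_indep_iff]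
            exact Or.inl ⟨hJE he, by rwa [hB.closure_eq_closure]⟩
          have heB : e ∉ B := fun h => heI (hB.subset h)
          have h1 : (insert e B).ncard ≤ rk M (insert e I) := by
            have h := mono _ _ (Set.insert_subset_insert (a := e) hB.subset)
            unfold rk at h ⊢
            rw [hins.eRk_eq_encard] at h
            exact h
          have h2 : rk M I = B.ncard := by
            unfold rk
            rw [hB.eRk_eq_encard]
            rfl
          rw [Set.ncard_insert_of_notMem heB (Set.toFinite B)] at h1
          have := (step e he heI).1
          omega
      have h1 : rk M J ≤ rk M I := by
        have h := mono _ _ hcl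
        unfold rk at h ⊢
        rwa [M.eRk_closure_eq] at h
      have h2 := (step e₀ he₀J he₀I).2
      omega)
    (fun _ h => h.1)).matroid

/-- The `r`-th generalized Hamming weight `d_r(M)` of a finite matroid, `1 ≤ r ≤ rk(M*)`: the
minimum size of a circuit of the elongation of `M` by rank `r - 1`. -/
def matroidWeight [Finite E] (M : Matroid E) (r : ℕ) : ℕ :=
  sInf {m | ∃ C : Set E, (elongation M (r - 1)).IsCircuit C ∧ m = C.ncard}

/-- The independence complex of a matroid. (In the Mathlib convention the empty face, which is
always present here, is not listed among the faces.) -/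
def independenceComplex (M : Matroid E) : PreAbstractSimplicialComplex E where
  faces := {U | U.Nonempty ∧ M.Indep (U : Set E)}
  isRelLowerSet_faces := fun _ hU =>
    ⟨hU.1, fun _ hVU hV => ⟨hV, hU.2.subset (Finset.coe_subset.2 hVU)⟩⟩

end Matroids

section Ideals

/-- The Stanley-Reisner ideal of a simplicial complex on the vertex set `E`, in the polynomial
ring over `L` with one variable for each element of `E`: it is generated by the squarefree
monomials `∏_{e ∈ U} x_e` of the non-faces `U`. -/
def stanleyReisnerIdeal (L : Type*) [Field L] {E : Type*} (Δ : PreAbstractSimplicialComplex E) :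
    Ideal (MvPolynomial E L) :=
  Ideal.span {f | ∃ U : Finset E, U.Nonempty ∧ U ∉ Δ ∧ f = ∏ e ∈ U, MvPolynomial.X e}

/-- The `s`-th symbolic power `I^(s) = ⋂_{P ∈ Ass(R/I)} (I^s R_P ∩ R)`. -/
def symbolicPower {R : Type*} [CommRing R] (I : Ideal R) (s : ℕ) : Ideal R :=
  ⨅ P : associatedPrimes R (R ⧸ I),
    ((I ^ s).map (algebraMap R (Localization.AtPrime P.1))).comap
      (algebraMap R (Localization.AtPrime P.1))

/-- The initial degree `α(I)` of a nonzero homogeneous ideal `I`: the least degree of a nonzero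
homogeneous element of `I`. -/
def initialDegree {L E : Type*} [Field L] (I : Ideal (MvPolynomial E L)) : ℕ :=
  sInf {d | ∃ f ∈ I, f ≠ 0 ∧ f.IsHomogeneous d}

/-- The Waldschmidt constant `inf_{s ≥ 1} α(I^(s)) / s` of a nonzero homogeneous ideal. -/
def waldschmidtConstant {L E : Type*} [Field L] (I : Ideal (MvPolynomial E L)) : ℝ :=
  sInf ((fun s : ℕ => (initialDegree (symbolicPower I s) : ℝ) / s) '' Set.Ici 1)

/-- `a` is the Waldschmidt constant of `I`, in both of its descriptions: as the infimum over
`s ≥ 1` and as the limit for `s → ∞` of `α(I^(s)) / s`. -/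
def IsWaldschmidtConstant {L E : Type*} [Field L] (I : Ideal (MvPolynomial E L)) (a : ℝ) : Prop :=
  waldschmidtConstant I = a ∧
    Tendsto (fun s : ℕ => (initialDegree (symbolicPower I s) : ℝ) / s) atTop (𝓝 a)

end Ideals

end

end MatroidWaldschmidt

namespace MatroidWaldschmidt

/-! ### Nullity, duality and the greedy bound. -/

section Nullity

variable {E : Type*}

/-! Everything reduces to one formula: the Waldschmidt constant of the Stanley-Reisner ideal of `M`
is the minimum of `|X| / nullity(X)` over the sets `X` of nonzero nullity
(`isWaldschmidtConstant_of_nullity`).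

For a base `A`, the variables outside `A` generate an associated prime, so an exponent vector
occurring in the `s`-th symbolic power has weight at least `s` on every cobase
(`symbolicPower_le_orderIdeal`). Let `A` be a base that restricts to a basis of every superlevel set
of the exponent vector `a`. The weight of `a` on the complement of `A` is then the sum of the
nullities of these sets, while the degree of `a` is the sum of their sizes. Comparing level by level
gives the lower bound (`mul_le_degree`). Conversely, the `t`-th power of the product of the
variables in `Y` lies in the `s`-th symbolic power once `s ≤ t * nullity M Y`
(`prod_pow_mem_symbolicPower`), which gives the upper bound.

The three minima are this minimum in disguise. Nullity in `M` is the corank of the complement in the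
dual, which yields flats; sets of nullity at least `r` are the dependent sets of the elongation by
`r - 1`; and for the dual of a code's matroid, nullity is the dimension of the subcode supported in
the set (`nullity_dual_columnMatroid`). -/

/-- A basis of the top of a chain that restricts to a basis of each member. -/
lemma exists_isBasis_chain {M : Matroid E} (hM : M.E = Set.univ) {Y : ℕ → Set E} (hY : Monotone Y)
    (n : ℕ) : ∃ I, M.IsBasis I (Y n) ∧ ∀ t ≤ n, M.IsBasis (I ∩ Y t) (Y t) := by
  induction n with
  | zero =>
    obtain ⟨I, hI⟩ := M.exists_isBasis (Y 0) (by simp [hM])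
    refine ⟨I, hI, fun t ht => ?_⟩
    obtain rfl : t = 0 := by omega
    rwa [Set.inter_eq_self_of_subset_left hI.subset]
  | succ n ih =>
    obtain ⟨I, hI, hIt⟩ := ih
    -- The extension of `I` leaves its trace on `Y n` unchanged, hence also its traces on all
    -- earlier members.
    obtain ⟨J, hJ, hIJ⟩ := hI.exists_isBasis_inter_eq_of_superset (hY n.le_succ) (by simp [hM])
    refine ⟨J, hJ, fun t ht => ?_⟩
    rcases ht.lt_or_eq with h | rfl
    · have h' : t ≤ n := by omega
      have : J ∩ Y t = I ∩ Y t := by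
        rw [← hIJ, Set.inter_assoc, Set.inter_eq_self_of_subset_right (hY h')]
      rw [this]
      exact hIt t h'
    · rwa [Set.inter_eq_self_of_subset_left hJ.subset]

variable [Finite E]

/-- The nullity `|X| - rk_M(X)` of a set in a finite matroid. -/
noncomputable def nullity (M : Matroid E) (X : Set E) : ℕ := X.ncard - rk M X

lemma cast_rk (M : Matroid E) (X : Set E) : (rk M X : ℕ∞) = M.eRk X :=
  ENat.natCast_toNat ((M.eRk_le_encard X).trans_lt (Set.toFinite X).encard_lt_top).ne

lemma cast_ncard (X : Set E) : (X.ncard : ℕ∞) = X.encard :=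
  (Set.toFinite X).cast_ncard_eq

lemma rk_le_ncard (M : Matroid E) (X : Set E) : rk M X ≤ X.ncard := by
  have := M.eRk_le_encard X
  rw [← cast_rk, ← cast_ncard] at this
  exact_mod_cast this

lemma nullity_add_rk (M : Matroid E) (X : Set E) : nullity M X + rk M X = X.ncard :=
  Nat.sub_add_cancel (rk_le_ncard M X)

lemma nullity_mono (M : Matroid E) {X Y : Set E} (h : X ⊆ Y) : nullity M X ≤ nullity M Y := by
  have h1 := M.eRk_union_le_eRk_add_encard X (Y \ X)
  rw [Set.union_sdiff_cancel h, ← cast_rk, ← cast_rk, ← cast_ncard] at h1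
  have h2 : rk M Y ≤ rk M X + (Y \ X).ncard := by exact_mod_cast h1
  have h3 := Set.ncard_sdiff_add_ncard_of_subset h (Set.toFinite Y)
  have := nullity_add_rk M X
  have := nullity_add_rk M Y
  omega

lemma ncard_le_rk {M : Matroid E} {I X : Set E} (hI : M.Indep I) (hIX : I ⊆ X) :
    I.ncard ≤ rk M X := by
  have := hI.encard_le_eRk_of_subset hIX
  rw [← cast_rk, ← cast_ncard] at this
  exact_mod_cast this

lemma ncard_eq_rk {M : Matroid E} {I X : Set E} (hI : M.IsBasis I X) : I.ncard = rk M X := by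
  have := hI.encard_eq_eRk
  rw [← cast_rk, ← cast_ncard] at this
  exact_mod_cast this

lemma nullity_le_ncard_diff {M : Matroid E} {A : Set E} (hA : M.Indep A) (X : Set E) :
    nullity M X ≤ (X \ A).ncard := by
  have h1 := ncard_le_rk (hA.subset (Set.inter_subset_right (s := X))) Set.inter_subset_left
  have h2 := Set.ncard_inter_add_ncard_sdiff_eq_ncard X A (Set.toFinite X)
  have := nullity_add_rk M X
  omega

lemma ncard_diff_eq_nullity {M : Matroid E} {A X : Set E} (h : M.IsBasis (A ∩ X) X) :
    (X \ A).ncard = nullity M X := by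
  have h1 := ncard_eq_rk h
  have h2 := Set.ncard_inter_add_ncard_sdiff_eq_ncard X A (Set.toFinite X)
  have := nullity_add_rk M X
  rw [Set.inter_comm] at h1
  omega

lemma rk_ground (M : Matroid E) : (rk M M.E : ℕ∞) = M.eRank := by
  rw [cast_rk, M.eRk_ground]

/-- The corank in the dual matroid is the nullity of the complement. -/
lemma crk_dual {M : Matroid E} (hM : M.E = Set.univ) (F : Set E) :
    crk M✶ F = nullity M Fᶜ := by
  have h1 := M.eRk_dual_add_eRank F (by simp [hM])
  have h2 := M.eRank_add_eRank_dual
  rw [← rk_ground, ← rk_ground, ← cast_ncard] at h2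
  rw [← rk_ground, ← cast_rk, ← cast_rk, ← cast_ncard] at h1
  norm_cast at h1 h2
  have h3 := nullity_add_rk M (M.E \ F)
  have h4 := Set.ncard_sdiff_add_ncard_of_subset (s := F) (t := M.E) (by simp [hM])
  rw [Set.compl_eq_univ_sdiff, ← hM]
  unfold crk
  omega

lemma nullity_univ {M : Matroid E} (hM : M.E = Set.univ) :
    nullity M Set.univ = rk M✶ M✶.E := by
  have := crk_dual hM ∅
  rw [Set.compl_empty] at this
  rw [← this]
  simp [crk, rk]

lemma nullity_dual {M : Matroid E} (hM : M.E = Set.univ) (X : Set E) :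
    nullity M✶ X = crk M Xᶜ := by
  rw [← compl_compl X, ← crk_dual (M := M✶) (by simpa using hM), M.dual_dual, compl_compl]

/-- Layer-cake summation: each `e ∈ S` is counted once for every level `t < a e`. -/
lemma weight_indicator_eq_sum (a : E →₀ ℕ) (S : Set E) {N : ℕ} (hN : ∀ e, a e ≤ N) :
    Finsupp.weight (S.indicator 1) a =
      ∑ t ∈ Finset.range N, ({e | t < a e} ∩ S).ncard := by
  classical
  cases nonempty_fintype E
  have h : ∀ t, ({e | t < a e} ∩ S).ncard
      = ∑ e, if t < a e then S.indicator (1 : E → ℕ) e else 0 := by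
    intro t
    rw [Set.ncard_eq_toFinset_card', Finset.card_eq_sum_ones, ← Finset.sum_subset
      (Finset.subset_univ (Set.toFinset ({e | t < a e} ∩ S)))]
    · refine Finset.sum_congr rfl fun e he => ?_
      simp only [Set.mem_toFinset, Set.mem_inter_iff, Set.mem_ofPred_eq] at he
      simp [he.1, he.2]
    · intro e _ he
      simp only [Set.mem_toFinset, Set.mem_inter_iff, Set.mem_ofPred_eq, not_and] at he
      split_ifs with h
      · simp [he h]
      · rfl
  simp_rw [h]
  rw [Finset.sum_comm, Finsupp.weight_eq_sum]
  refine Finset.sum_congr rfl fun e _ => ?_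
  rw [← Finset.sum_filter, Finset.sum_const, smul_eq_mul, smul_eq_mul]
  congr 1
  rw [show (Finset.range N).filter (fun t => t < a e) = Finset.range (a e) by
    ext t
    have := hN e
    simp only [Finset.mem_filter, Finset.mem_range]
    omega, Finset.card_range]

/-- The greedy algorithm: the minimum weight of a cobase is the sum of the nullities of the
superlevel sets, so it is bounded by the total weight if cardinality dominates nullity. -/
lemma mul_le_degree {M : Matroid E} (hM : M.E = Set.univ) {c : ℝ} (hc : 0 ≤ c)
    (hcX : ∀ X, c * nullity M X ≤ X.ncard) (a : E →₀ ℕ) {s : ℕ}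
    (ha : ∀ A, M.IsBase A → s ≤ Finsupp.weight (Aᶜ.indicator 1) a) :
    c * s ≤ a.degree := by
  classical
  cases nonempty_fintype E
  set N := ∑ e, a e with hNdef
  have hN : ∀ e, a e ≤ N := fun e => Finset.single_le_sum (fun _ _ => Nat.zero_le _)
    (Finset.mem_univ e)
  -- Superlevel sets shrink as the level grows, so they are indexed backwards to form an increasing
  -- chain: `{t < a e}` is the member with index `N - t - 1`.
  obtain ⟨A, hA, hAt⟩ := exists_isBasis_chain hM (Y := fun t => {e | N ≤ a e + t})
    (fun s t hst e he => le_trans he (Nat.add_le_add_left hst _)) N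
  have htop : {e | N ≤ a e + N} = M.E := by ext e; simp [hM]
  have hbase : M.IsBase A := by
    rw [← Matroid.isBasis_ground_iff, ← htop]
    exact hA
  have h1 := ha A hbase
  rw [weight_indicator_eq_sum a _ hN] at h1
  have h2 : ∀ t ∈ Finset.range N, ({e | t < a e} ∩ Aᶜ).ncard = nullity M {e | t < a e} := by
    intro t ht
    rw [← ncard_diff_eq_nullity (A := A), Set.sdiff_eq]
    have := hAt (N - t - 1) (by omega)
    have h3 : {e | N ≤ a e + (N - t - 1)} = {e | t < a e} := by
      ext e
      have := Finset.mem_range.1 ht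
      simp only [Set.mem_ofPred_eq]
      omega
    rwa [h3] at this
  rw [Finset.sum_congr rfl h2] at h1
  have h3 : a.degree = ∑ t ∈ Finset.range N, ({e | t < a e} : Set E).ncard := by
    have := weight_indicator_eq_sum a Set.univ hN
    simp only [Set.inter_univ, Set.indicator_univ] at this
    rw [← this, Finsupp.degree_eq_weight_one]
    rfl
  rw [h3]
  calc c * s ≤ c * ((∑ t ∈ Finset.range N, nullity M {e | t < a e} : ℕ) : ℝ) := by gcongr
    _ = ∑ t ∈ Finset.range N, c * nullity M {e | t < a e} := by
      push_cast
      rw [Finset.mul_sum]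
    _ ≤ _ := by
      push_cast
      exact Finset.sum_le_sum fun t _ => hcX _

end Nullity

/-! ### Weighted orders of polynomials. -/

section MonomialOrders

variable {L E : Type*} [Field L]

open MvPolynomial

/-- The ideal of the polynomials all of whose monomials have weight at least `n`. -/
noncomputable def orderIdeal (L : Type*) [Field L] {E : Type*} (w : E → ℕ) (n : ℕ) :
    Ideal (MvPolynomial E L) where
  carrier := {f | (n : ℕ∞) ≤ (f : MvPowerSeries E L).weightedOrder w}
  zero_mem' := by simp
  add_mem' {f g} hf hg := by
    simp only [Set.mem_ofPred_eq, MvPolynomial.coe_add] at *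
    exact (le_min hf hg).trans (MvPowerSeries.min_weightedOrder_le_add w)
  smul_mem' f g hg := by
    simp only [Set.mem_ofPred_eq, smul_eq_mul, MvPolynomial.coe_mul,
      MvPowerSeries.weightedOrder_mul] at *
    exact hg.trans le_add_self

lemma mem_orderIdeal {w : E → ℕ} {n : ℕ} {f : MvPolynomial E L} :
    f ∈ orderIdeal L w n ↔ (n : ℕ∞) ≤ (f : MvPowerSeries E L).weightedOrder w :=
  Iff.rfl

lemma mem_orderIdeal_iff_forall {w : E → ℕ} {n : ℕ} {f : MvPolynomial E L} :
    f ∈ orderIdeal L w n ↔ ∀ m ∈ f.support, n ≤ Finsupp.weight w m := by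
  rw [mem_orderIdeal]
  constructor
  · intro h m hm
    have := MvPowerSeries.weightedOrder_le w (f := (f : MvPowerSeries E L)) (d := m)
      (by rwa [coeff_coe, ← mem_support_iff])
    exact_mod_cast h.trans this
  · intro h
    refine MvPowerSeries.nat_le_weightedOrder w fun d hd => ?_
    rw [coeff_coe]
    by_contra hne
    have := h d (mem_support_iff.2 hne)
    omega

lemma orderIdeal_pow_le (w : E → ℕ) (n s : ℕ) : orderIdeal L w n ^ s ≤ orderIdeal L w (s * n) := by
  induction s with
  | zero => intro f _; simp [mem_orderIdeal]
  | succ s ih =>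
    rw [pow_succ, Ideal.mul_le]
    intro f hf g hg
    have hf' := mem_orderIdeal.1 (ih hf)
    rw [mem_orderIdeal] at hg ⊢
    rw [MvPolynomial.coe_mul, MvPowerSeries.weightedOrder_mul, Nat.succ_mul]
    push_cast at hf' ⊢
    exact add_le_add hf' hg

lemma weightedOrder_eq_zero {w : E → ℕ} {f : MvPolynomial E L} (hf : f ∉ orderIdeal L w 1) :
    (f : MvPowerSeries E L).weightedOrder w = 0 := by
  rw [mem_orderIdeal, Nat.cast_one, Order.one_le_iff_ne_zero, not_not] at hf
  exact hf

/-- Weighted order is additive on products, so a factor of order zero can be cancelled. This is what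
removes denominators after localization. -/
lemma mem_orderIdeal_of_mul_mem {w : E → ℕ} {n : ℕ} {f g : MvPolynomial E L}
    (hf : f ∉ orderIdeal L w 1) (h : f * g ∈ orderIdeal L w n) : g ∈ orderIdeal L w n := by
  rwa [mem_orderIdeal, MvPolynomial.coe_mul, MvPowerSeries.weightedOrder_mul,
    weightedOrder_eq_zero hf, zero_add] at h

lemma isPrime_orderIdeal_one (w : E → ℕ) : (orderIdeal L w 1).IsPrime where
  ne_top' := by
    rw [Ideal.ne_top_iff_one, mem_orderIdeal, MvPolynomial.coe_one,
      MvPowerSeries.weightedOrder_one]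
    simp
  mem_or_mem' {f g} h := by
    by_contra! hcon
    exact hcon.2 (mem_orderIdeal_of_mul_mem hcon.1 h)

lemma one_le_weight_indicator {S : Set E} {m : E →₀ ℕ} :
    1 ≤ Finsupp.weight (S.indicator (1 : E → ℕ)) m ↔ ∃ e ∈ S, m e ≠ 0 := by
  classical
  rw [Nat.one_le_iff_ne_zero, Finsupp.weight_apply, Finsupp.sum, ne_eq, Finset.sum_eq_zero_iff]
  push Not
  constructor
  · rintro ⟨e, he, h⟩
    exact ⟨e, by_contra fun hS => h (by simp [hS]), Finsupp.mem_support_iff.1 he⟩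
  · rintro ⟨e, heS, he⟩
    exact ⟨e, Finsupp.mem_support_iff.2 he, by simp [heS, he]⟩

lemma orderIdeal_indicator_one (S : Set E) :
    orderIdeal L (S.indicator 1) 1 = Ideal.span (X '' S) := by
  ext f
  rw [mem_orderIdeal_iff_forall, mem_ideal_span_X_image]
  simp_rw [one_le_weight_indicator]

end MonomialOrders

/-! ### Associated primes and symbolic powers of the Stanley-Reisner ideal. -/

section SymbolicPowers

variable {L E : Type*} [Field L] {M : Matroid E}

open MvPolynomial

lemma prod_mem_stanleyReisnerIdeal {U : Finset E} (hU : ¬ M.Indep (U : Set E)) :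
    ∏ e ∈ U, X e ∈ stanleyReisnerIdeal L (independenceComplex M) := by
  refine Ideal.subset_span ⟨U, ?_, fun h => hU h.2, rfl⟩
  rw [Finset.nonempty_iff_ne_empty]
  rintro rfl
  simp at hU

lemma stanleyReisnerIdeal_le {J : Ideal (MvPolynomial E L)}
    (h : ∀ U : Finset E, ¬ M.Indep (U : Set E) → ∏ e ∈ U, X e ∈ J) :
    stanleyReisnerIdeal L (independenceComplex M) ≤ J := by
  rw [stanleyReisnerIdeal, Ideal.span_le]
  rintro _ ⟨U, hU, hUM, rfl⟩
  exact h U fun hi => hUM ⟨hU, hi⟩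

lemma monomial_mem_stanleyReisnerIdeal {m : E →₀ ℕ} (c : L)
    (hm : ¬ M.Indep (m.support : Set E)) :
    monomial m c ∈ stanleyReisnerIdeal L (independenceComplex M) := by
  rw [monomial_eq]
  refine Ideal.mul_mem_left _ _ (Ideal.mem_of_dvd _ ?_ (prod_mem_stanleyReisnerIdeal hm))
  exact Finset.prod_dvd_prod_of_dvd _ _ fun e he =>
    dvd_pow_self _ (Finsupp.mem_support_iff.1 he)

lemma stanleyReisnerIdeal_le_orderIdeal {A : Set E} (hA : M.Indep A) :
    stanleyReisnerIdeal L (independenceComplex M) ≤ orderIdeal L (Aᶜ.indicator 1) 1 := by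
  refine stanleyReisnerIdeal_le fun U hU => ?_
  have hUA : ¬ (U : Set E) ⊆ A := fun h => hU (hA.subset h)
  obtain ⟨e, heU, heA⟩ := Set.not_subset.1 hUA
  rw [orderIdeal_indicator_one]
  exact Ideal.mem_of_dvd _ (Finset.dvd_prod_of_mem _ heU)
    (Ideal.subset_span ⟨e, heA, rfl⟩)

/-- A base together with one more element is dependent. Since the product over `A` avoids the prime
of `A`, this puts `X e` into the localized ideal. -/
lemma X_mul_prod_mem {A : Finset E} (hA : M.IsBase (A : Set E)) {e : E} (he : e ∉ A) :
    (X e * ∏ i ∈ A, X i : MvPolynomial E L) ∈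
      stanleyReisnerIdeal L (independenceComplex M) := by
  classical
  rw [← Finset.prod_insert he]
  refine prod_mem_stanleyReisnerIdeal fun h => he ?_
  have := hA.eq_of_subset_indep h (by simp)
  have h2 : e ∈ (A : Set E) := this ▸ (by simp)
  exact_mod_cast h2

lemma prod_notMem_orderIdeal (A : Finset E) :
    (∏ i ∈ A, X i : MvPolynomial E L) ∉ orderIdeal L ((A : Set E)ᶜ.indicator 1) 1 := by
  have := isPrime_orderIdeal_one (L := L) ((A : Set E)ᶜ.indicator 1)
  rw [Ideal.IsPrime.prod_mem_iff]
  rintro ⟨i, hi, h⟩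
  rw [mem_orderIdeal_iff_forall] at h
  have := h (Finsupp.single i 1) (by simp [mem_support_iff])
  rw [one_le_weight_indicator] at this
  obtain ⟨e, he, hne⟩ := this
  rw [Finsupp.single_apply_ne_zero] at hne
  exact he (hne.1 ▸ hi)

variable [Finite E]

/-- The prime is the annihilator of the class of the product of the variables in `A`. -/
lemma orderIdeal_mem_associatedPrimes {A : Set E} (hA : M.IsBase A) :
    orderIdeal L (Aᶜ.indicator 1) 1 ∈ associatedPrimes (MvPolynomial E L)
      (MvPolynomial E L ⧸ stanleyReisnerIdeal L (independenceComplex M)) := by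
  obtain ⟨A, rfl⟩ := A.toFinite.exists_finset_coe
  rw [AssociatedPrimes.mem_iff, isAssociatedPrime_iff]
  refine ⟨isPrime_orderIdeal_one _, Ideal.Quotient.mk _ (∏ i ∈ A, X i), le_antisymm ?_ ?_⟩
  · rw [orderIdeal_indicator_one, Ideal.span_le]
    rintro _ ⟨e, he, rfl⟩
    rw [SetLike.mem_coe, Submodule.mem_colon_singleton, Submodule.mem_bot, ← Ideal.Quotient.mk_eq_mk,
      ← Submodule.Quotient.mk_smul, Submodule.Quotient.mk_eq_zero]
    exact X_mul_prod_mem hA (by simpa using he)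
  · intro f hf
    rw [Submodule.mem_colon_singleton, Submodule.mem_bot, ← Ideal.Quotient.mk_eq_mk,
      ← Submodule.Quotient.mk_smul, Submodule.Quotient.mk_eq_zero, smul_eq_mul, mul_comm] at hf
    exact mem_orderIdeal_of_mul_mem (prod_notMem_orderIdeal A)
      (stanleyReisnerIdeal_le_orderIdeal hA.indep hf)

lemma symbolicPower_le_orderIdeal {A : Set E} (hA : M.IsBase A) (s : ℕ) :
    symbolicPower (stanleyReisnerIdeal L (independenceComplex M)) s ≤
      orderIdeal L (Aᶜ.indicator 1) s := by
  intro f hf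
  have hP := orderIdeal_mem_associatedPrimes (L := L) hA
  have := isPrime_orderIdeal_one (L := L) (Aᶜ.indicator 1)
  have h := Submodule.mem_iInf _ |>.1 hf ⟨_, hP⟩
  rw [Ideal.mem_comap, IsLocalization.algebraMap_mem_map_algebraMap_iff
    (orderIdeal L (Aᶜ.indicator 1) 1).primeCompl] at h
  obtain ⟨g, hg, hgf⟩ := h
  refine mem_orderIdeal_of_mul_mem hg ?_
  have h1 := Ideal.pow_right_mono (stanleyReisnerIdeal_le_orderIdeal (L := L) hA.indep) s hgf
  simpa using orderIdeal_pow_le _ 1 s h1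

/-- Containment suffices for the upper bound: whatever avoids the larger prime also avoids `P` and
is a unit after localization at `P`. -/
lemma exists_isBase_of_mem_associatedPrimes {P : Ideal (MvPolynomial E L)}
    (hP : P ∈ associatedPrimes (MvPolynomial E L)
      (MvPolynomial E L ⧸ stanleyReisnerIdeal L (independenceComplex M))) :
    ∃ A : Set E, M.IsBase A ∧ P ≤ orderIdeal L (Aᶜ.indicator 1) 1 := by
  rw [AssociatedPrimes.mem_iff, isAssociatedPrime_iff] at hP
  obtain ⟨hP, x, rfl⟩ := hP
  obtain ⟨g, rfl⟩ := Ideal.Quotient.mk_surjective x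
  have hmem : ∀ f, f ∈ Submodule.colon ⊥ {Ideal.Quotient.mk
      (stanleyReisnerIdeal L (independenceComplex M)) g} ↔
      f * g ∈ stanleyReisnerIdeal L (independenceComplex M) := by
    intro f
    rw [Submodule.mem_colon_singleton, Submodule.mem_bot, ← Ideal.Quotient.mk_eq_mk,
      ← Submodule.Quotient.mk_smul, Submodule.Quotient.mk_eq_zero, smul_eq_mul]
  have hg : g ∉ stanleyReisnerIdeal L (independenceComplex M) := by
    have := (Ideal.ne_top_iff_one _).1 hP.ne_top
    rwa [hmem, one_mul] at this
  -- The ideal contains the intersection of the base primes: a monomial with independent support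
  -- misses the prime of any base containing that support.
  obtain ⟨A, hA, hgA⟩ : ∃ A, M.IsBase A ∧ g ∉ orderIdeal L (Aᶜ.indicator 1) 1 := by
    by_contra! hcon
    refine hg ?_
    rw [g.as_sum]
    refine Ideal.sum_mem _ fun m hm => monomial_mem_stanleyReisnerIdeal _ fun hi => ?_
    obtain ⟨B, hB, hmB⟩ := hi.exists_isBase_superset
    obtain ⟨e, he, hme⟩ := one_le_weight_indicator.1
      (mem_orderIdeal_iff_forall.1 (hcon B hB) m hm)
    exact he (hmB (by simpa using hme))
  refine ⟨A, hA, fun f hf => mem_orderIdeal_of_mul_mem hgA ?_⟩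
  rw [mul_comm]
  exact stanleyReisnerIdeal_le_orderIdeal hA.indep ((hmem f).1 hf)

lemma prod_pow_mem_symbolicPower (U : Finset E) {s t : ℕ} (hst : s ≤ t * nullity M U) :
    (∏ e ∈ U, X e) ^ t ∈ symbolicPower (stanleyReisnerIdeal L (independenceComplex M)) s := by
  classical
  refine Submodule.mem_iInf _ |>.2 fun ⟨P, hP⟩ => ?_
  have hPp : P.IsPrime := hP.1
  rw [Ideal.mem_comap, IsLocalization.algebraMap_mem_map_algebraMap_iff P.primeCompl]
  obtain ⟨A, hA, hPA⟩ := exists_isBase_of_mem_associatedPrimes hP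
  obtain ⟨A, rfl⟩ := A.toFinite.exists_finset_coe
  -- One copy of the product over `A` for each element of `U \ A` moves that variable into the
  -- ideal. There are at least `nullity M U` such elements, as `A` is independent.
  refine ⟨((∏ i ∈ A, X i) ^ (U \ A).card) ^ t,
    pow_mem (pow_mem (show _ ∈ P.primeCompl from
      fun h => prod_notMem_orderIdeal A (hPA h)) _) _, ?_⟩
  have h1 : ∏ e ∈ U \ A, (X e * ∏ i ∈ A, X i : MvPolynomial E L) ∈
      stanleyReisnerIdeal L (independenceComplex M) ^ (U \ A).card := by
    rw [← Finset.prod_const]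
    exact Ideal.prod_mem_prod fun e he => X_mul_prod_mem hA (Finset.mem_sdiff.1 he).2
  have h2 : s ≤ (U \ A).card * t := by
    have := nullity_le_ncard_diff hA.indep (U : Set E)
    rw [← Finset.coe_sdiff, Set.ncard_coe_finset] at this
    rw [mul_comm]
    exact hst.trans (Nat.mul_le_mul_left t this)
  have h3 := Ideal.pow_le_pow_right h2 (pow_mul (stanleyReisnerIdeal L (independenceComplex M)) _ _ ▸
    Ideal.pow_mem_pow h1 t)
  refine Ideal.mem_of_dvd _ ?_ h3
  rw [← mul_pow]
  refine pow_dvd_pow_of_dvd ?_ t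
  rw [Finset.prod_mul_distrib, Finset.prod_const, mul_comm]
  exact mul_dvd_mul_left _ (Finset.prod_dvd_prod_of_subset _ _ _ Finset.sdiff_subset)

lemma initialDegree_symbolicPower_le (Y : Set E) {s t : ℕ} (hst : s ≤ t * nullity M Y) :
    initialDegree (symbolicPower (stanleyReisnerIdeal L (independenceComplex M)) s) ≤
      t * Y.ncard := by
  obtain ⟨U, rfl⟩ := Y.toFinite.exists_finset_coe
  refine Nat.sInf_le ⟨_, prod_pow_mem_symbolicPower U hst,
    pow_ne_zero _ (Finset.prod_ne_zero_iff.2 fun e _ => X_ne_zero e), ?_⟩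
  have := (IsHomogeneous.prod U (fun e => (X e : MvPolynomial E L)) (fun _ => 1)
    fun e _ => isHomogeneous_X L e).pow t
  rw [Set.ncard_coe_finset, mul_comm]
  simpa using this

lemma mul_le_initialDegree (hM : M.E = Set.univ) {c : ℝ} (hc : 0 ≤ c)
    (hcX : ∀ X, c * nullity M X ≤ X.ncard) {Y : Set E} (hY : nullity M Y ≠ 0) (s : ℕ) :
    c * s ≤ initialDegree (symbolicPower (stanleyReisnerIdeal L (independenceComplex M)) s) := by
  -- Nonemptiness makes the infimum a degree that is attained, not the default `0` of `sInf ∅`.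
  have hne : {d | ∃ f ∈ symbolicPower (stanleyReisnerIdeal L (independenceComplex M)) s,
      f ≠ 0 ∧ f.IsHomogeneous d}.Nonempty := by
    obtain ⟨U, rfl⟩ := Y.toFinite.exists_finset_coe
    refine ⟨_, _, prod_pow_mem_symbolicPower U
      (Nat.le_mul_of_pos_right s (Nat.pos_of_ne_zero hY)),
      pow_ne_zero _ (Finset.prod_ne_zero_iff.2 fun e _ => X_ne_zero e),
      (IsHomogeneous.prod U (fun e => (X e : MvPolynomial E L)) (fun _ => 1)
        fun e _ => isHomogeneous_X L e).pow s⟩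
  obtain ⟨f, hf, hf0, hfd⟩ := Nat.sInf_mem hne
  obtain ⟨m, hm⟩ := support_nonempty.2 hf0
  have h := mul_le_degree hM hc hcX m (s := s) fun A hA =>
    mem_orderIdeal_iff_forall.1 (symbolicPower_le_orderIdeal hA s hf) m hm
  have hdeg := hfd (mem_support_iff.1 hm)
  rw [Finsupp.degree_eq_weight_one] at h
  change Finsupp.weight (fun _ => 1) m = _ at hdeg
  rw [hdeg] at h
  exact h

/-- The Waldschmidt constant of the Stanley-Reisner ideal of a matroid is the least ratio of
cardinality to nullity. -/
lemma isWaldschmidtConstant_of_nullity (hM : M.E = Set.univ) {Y : Set E} (hY : nullity M Y ≠ 0)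
    (hmin : ∀ X, (Y.ncard : ℝ) / nullity M Y * nullity M X ≤ X.ncard) :
    IsWaldschmidtConstant (stanleyReisnerIdeal L (independenceComplex M))
      ((Y.ncard : ℝ) / nullity M Y) := by
  set c : ℝ := (Y.ncard : ℝ) / nullity M Y with hcdef
  set α := fun s => initialDegree
    (symbolicPower (stanleyReisnerIdeal L (independenceComplex M)) s) with hα
  have hη : (0 : ℝ) < nullity M Y := by exact_mod_cast Nat.pos_of_ne_zero hY
  have hc : 0 ≤ c := by positivity
  have hlow : ∀ s, 1 ≤ s → c ≤ (α s : ℝ) / s := fun s hs => by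
    have : (0 : ℝ) < s := by exact_mod_cast hs
    rw [le_div_iff₀ this]
    exact mul_le_initialDegree hM hc hmin hY s
  have hupp : ∀ s, 1 ≤ s → (α s : ℝ) / s ≤ c + Y.ncard / s := fun s hs => by
    have hs' : (0 : ℝ) < s := by exact_mod_cast hs
    -- The exponent `t = s / nullity M Y + 1` overshoots `s / nullity` by at most one, costing an
    -- error of at most `|Y| / s` in the ratio.
    have h1 : s ≤ (s / nullity M Y + 1) * nullity M Y := by
      have := Nat.div_add_mod s (nullity M Y)
      have := Nat.mod_lt s (Nat.pos_of_ne_zero hY)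
      rw [add_mul, one_mul, mul_comm]
      omega
    have h2 : (α s : ℝ) ≤ (((s / nullity M Y + 1) * Y.ncard : ℕ) : ℝ) := by
      exact_mod_cast initialDegree_symbolicPower_le (L := L) Y h1
    have h3 : (((s / nullity M Y : ℕ)) : ℝ) ≤ s / nullity M Y := Nat.cast_div_le
    push_cast at h2
    rw [div_le_iff₀ hs', add_mul, div_mul_cancel₀ _ hs'.ne']
    calc (α s : ℝ) ≤ (((s / nullity M Y : ℕ) : ℝ) + 1) * Y.ncard := h2
      _ ≤ ((s : ℝ) / nullity M Y + 1) * Y.ncard := by gcongr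
      _ = c * s + Y.ncard := by rw [hcdef]; ring
  constructor
  -- The infimum is attained at `s = nullity M Y`, by the squarefree monomial of `Y`.
  · refine IsLeast.csInf_eq ⟨⟨nullity M Y, Nat.one_le_iff_ne_zero.2 hY, ?_⟩, ?_⟩
    · refine le_antisymm ?_ (hlow _ (Nat.one_le_iff_ne_zero.2 hY))
      refine div_le_div_of_nonneg_right ?_ hη.le
      have := initialDegree_symbolicPower_le (L := L) (M := M) Y (s := nullity M Y) (t := 1)
        (by simp)
      rw [one_mul] at this
      exact_mod_cast this
    · rintro _ ⟨s, hs, rfl⟩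
      exact hlow s hs
  · have hlim : Tendsto (fun s : ℕ => c + (Y.ncard : ℝ) / s) atTop (𝓝 c) := by
      simpa using (tendsto_const_nhds (x := c)).add (tendsto_const_div_atTop_nhds_zero_nat
        (Y.ncard : ℝ))
    refine tendsto_of_tendsto_of_tendsto_of_le_of_le' tendsto_const_nhds hlim ?_ ?_
    · filter_upwards [eventually_ge_atTop 1] with s hs using hlow s hs
    · filter_upwards [eventually_ge_atTop 1] with s hs using hupp s hs

end SymbolicPowers

/-! ### Weights and flats as forms of the same minimum. -/

section Minima

variable {E : Type*} {M : Matroid E}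

lemma crk_closure (M : Matroid E) (X : Set E) : crk M (M.closure X) = crk M X := by
  simp [crk, rk]

lemma min_mul_nullity_le {Y : Set E}
    (hmin : ∀ X, nullity M X ≠ 0 →
      (Y.ncard : ℝ) / nullity M Y ≤ (X.ncard : ℝ) / nullity M X) (X : Set E) :
    (Y.ncard : ℝ) / nullity M Y * nullity M X ≤ X.ncard := by
  by_cases hX : nullity M X = 0
  · simp [hX]
  · rw [← le_div_iff₀ (by exact_mod_cast Nat.pos_of_ne_zero hX)]
    exact hmin X hX

variable [Finite E]

lemma exists_min_ncard_div_nullity (h : nullity M Set.univ ≠ 0) :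
    ∃ Y, nullity M Y ≠ 0 ∧ ∀ X, nullity M X ≠ 0 →
      (Y.ncard : ℝ) / nullity M Y ≤ (X.ncard : ℝ) / nullity M X :=
  Set.exists_min_image {X | nullity M X ≠ 0} (fun X => (X.ncard : ℝ) / nullity M X)
    (Set.toFinite _) ⟨_, h⟩

/-- A weight hierarchy that measures the sets of given nullity attains the least ratio of
cardinality to nullity. -/
lemma isLeast_weight_div {wt : ℕ → ℕ} {Y : Set E} (hY : nullity M Y ≠ 0)
    (hmin : ∀ X, nullity M X ≠ 0 →
      (Y.ncard : ℝ) / nullity M Y ≤ (X.ncard : ℝ) / nullity M X)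
    (h1 : ∀ r, 1 ≤ r → r ≤ nullity M Set.univ → ∃ X, r ≤ nullity M X ∧ wt r = X.ncard)
    (h2 : ∀ X, nullity M X ≠ 0 → wt (nullity M X) ≤ X.ncard) :
    IsLeast {x : ℝ | ∃ r : ℕ, 1 ≤ r ∧ r ≤ nullity M Set.univ ∧ x = (wt r : ℝ) / r}
      ((Y.ncard : ℝ) / nullity M Y) := by
  have hlow : ∀ r, 1 ≤ r → r ≤ nullity M Set.univ →
      (Y.ncard : ℝ) / nullity M Y ≤ (wt r : ℝ) / r := by
    intro r hr hrk
    obtain ⟨X, hrX, hX⟩ := h1 r hr hrk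
    rw [hX]
    -- Only `r ≤ nullity M X` is known; replacing the denominator by the smaller `r` can only
    -- increase the ratio.
    refine (hmin X (by omega)).trans ?_
    have : (0 : ℝ) < r := by exact_mod_cast hr
    gcongr
  have hY1 := Nat.one_le_iff_ne_zero.2 hY
  have hYk := nullity_mono M (Set.subset_univ Y)
  refine ⟨⟨nullity M Y, hY1, hYk, le_antisymm (hlow _ hY1 hYk) ?_⟩, ?_⟩
  · have := h2 Y hY
    gcongr
  · rintro _ ⟨r, hr, hrk, rfl⟩
    exact hlow r hr hrk

lemma elongation_dep {r : ℕ} {A : Set E} (hM : M.E = Set.univ) :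
    (elongation M r).Dep A ↔ r < nullity M A := by
  have hE : (elongation M r).E = M.E := rfl
  have hI : (elongation M r).Indep A ↔ A ⊆ M.E ∧ A.ncard ≤ rk M A + r := by
    simp [elongation]
  rw [Matroid.Dep, hI, hE, hM]
  have := nullity_add_rk M A
  simp only [Set.subset_univ, true_and, and_true]
  omega

lemma exists_matroidWeight_eq (hM : M.E = Set.univ) {r : ℕ} (hr : 1 ≤ r)
    (hrk : r ≤ nullity M Set.univ) :
    ∃ X, r ≤ nullity M X ∧ matroidWeight M r = X.ncard := by
  have hdep : (elongation M (r - 1)).Dep Set.univ := (elongation_dep hM).2 (by omega)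
  obtain ⟨C, -, hC⟩ := hdep.exists_isCircuit_subset
  obtain ⟨C', hC', h⟩ : matroidWeight M r ∈
      {m | ∃ C : Set E, (elongation M (r - 1)).IsCircuit C ∧ m = C.ncard} :=
    Nat.sInf_mem ⟨_, C, hC, rfl⟩
  have := (elongation_dep hM).1 hC'.dep
  exact ⟨C', by omega, h⟩

lemma matroidWeight_nullity_le (hM : M.E = Set.univ) {X : Set E} (hX : nullity M X ≠ 0) :
    matroidWeight M (nullity M X) ≤ X.ncard := by
  have hdep : (elongation M (nullity M X - 1)).Dep X := (elongation_dep hM).2 (by omega)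
  obtain ⟨C, hCX, hC⟩ := hdep.exists_isCircuit_subset
  exact (Nat.sInf_le ⟨C, hC, rfl⟩ : matroidWeight M (nullity M X) ≤ C.ncard).trans
    (Set.ncard_le_ncard hCX)

lemma nullity_compl_ne_zero_of_isFlat (hM : M.E = Set.univ) {F : Set E} (hF : M✶.IsFlat F)
    (hFE : F ≠ M.E) : nullity M Fᶜ ≠ 0 := by
  rw [← crk_dual hM]
  intro h
  have hsp : M✶.Spanning F := by
    have h1 : F ⊆ M✶.E := hF.subset_ground
    rw [Matroid.spanning_iff_eRk_le h1, ← rk_ground, ← cast_rk]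
    unfold crk at h
    exact_mod_cast (by omega : rk M✶ M✶.E ≤ rk M✶ F)
  exact hFE (hF.closure.symm.trans hsp.closure_eq)

/-- Closing the complement of a minimizer in the dual keeps its corank and can only shrink what is
left outside, so the minimum is attained at a flat. -/
lemma isLeast_flat_ratio (hM : M.E = Set.univ) {Y : Set E} (hY : nullity M Y ≠ 0)
    (hmin : ∀ X, nullity M X ≠ 0 →
      (Y.ncard : ℝ) / nullity M Y ≤ (X.ncard : ℝ) / nullity M X) :
    IsLeast {x : ℝ | ∃ F : Set E, M✶.IsFlat F ∧ F ≠ M.E ∧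
      x = ((M.E \ F).ncard : ℝ) / crk M✶ F} ((Y.ncard : ℝ) / nullity M Y) := by
  have hcompl : ∀ F : Set E, M.E \ F = Fᶜ := fun F => by rw [hM, Set.compl_eq_univ_sdiff]
  constructor
  · have hcl : crk M✶ (M✶.closure Yᶜ) = nullity M Y := by
      rw [crk_closure, crk_dual hM, compl_compl]
    have hFE : M✶.closure Yᶜ ≠ M.E := by
      intro h
      rw [h] at hcl
      simp [crk] at hcl
      exact hY hcl.symm
    have hsub : (M✶.closure Yᶜ)ᶜ ⊆ Y := by
      rw [Set.compl_subset_comm]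
      exact M✶.subset_closure _ (by simp [hM])
    refine ⟨M✶.closure Yᶜ, M✶.isFlat_closure _, hFE, le_antisymm ?_ ?_⟩
    · have := hmin (M✶.closure Yᶜ)ᶜ (by rwa [← crk_dual hM, hcl])
      rwa [hcompl, crk_dual hM]
    · rw [hcl, hcompl]
      have := Set.ncard_le_ncard hsub
      gcongr
  · rintro _ ⟨F, hF, hFE, rfl⟩
    rw [hcompl, crk_dual hM]
    exact hmin _ (nullity_compl_ne_zero_of_isFlat hM hF hFE)

end Minima

/-! ### Linear codes and their column matroids. -/

section Codes

variable {K : Type*} [Field K] {k n : ℕ}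

lemma columnMatroid_ground (G : Matrix (Fin k) (Fin n) K) :
    (columnMatroid G).E = Set.univ := rfl

lemma columnMatroid_indep (G : Matrix (Fin k) (Fin n) K) {J : Set (Fin n)} :
    (columnMatroid G).Indep J ↔ LinearIndepOn K G.col J := by
  simp [columnMatroid]

lemma rk_columnMatroid (G : Matrix (Fin k) (Fin n) K) (A : Set (Fin n)) :
    rk (columnMatroid G) A = Module.finrank K (Submodule.span K (G.col '' A)) := by
  classical
  obtain ⟨I, hI⟩ := (columnMatroid G).exists_isBasis A (Set.subset_univ A)
  have hind := (columnMatroid_indep G).1 hI.indep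
  have hspan : Submodule.span K (G.col '' A) = Submodule.span K (G.col '' I) := by
    refine le_antisymm (Submodule.span_le.2 ?_) (Submodule.span_mono (Set.image_mono hI.subset))
    rintro _ ⟨e, he, rfl⟩
    by_cases heI : e ∈ I
    · exact Submodule.subset_span ⟨e, heI, rfl⟩
    · by_contra hn
      exact heI (hI.mem_of_insert_indep he ((columnMatroid_indep G).2 (hind.insert hn)))
  rw [hspan, ← ncard_eq_rk hI, Set.image_eq_range, finrank_span_eq_card (R := K)
    (b := fun i : I => G.col i) hind, ← Nat.card_eq_fintype_card, Nat.card_coe_set_eq]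

/-- The subcode of the codewords supported in `Y`. -/
def shortenedCode (C : Submodule K (Fin n → K)) (Y : Set (Fin n)) : Submodule K (Fin n → K) :=
  C ⊓ LinearMap.ker (LinearMap.funLeft K K (Subtype.val : ↥(Yᶜ) → Fin n))

lemma mem_shortenedCode {C : Submodule K (Fin n → K)} {Y : Set (Fin n)} {c : Fin n → K} :
    c ∈ shortenedCode C Y ↔ c ∈ C ∧ ∀ i ∉ Y, c i = 0 := by
  rw [shortenedCode, Submodule.mem_inf, LinearMap.mem_ker]
  refine and_congr_right fun _ => ⟨fun h i hi => congrFun h ⟨i, hi⟩, fun h => ?_⟩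
  ext ⟨i, hi⟩
  exact h i hi

/-- Rank-nullity for the restriction of codewords to the complement of `Y`: the kernel is the
shortened code, and the image is the row space of a column submatrix, whose row rank equals its
column rank. -/
lemma finrank_shortenedCode_add_rk {C : Submodule K (Fin n → K)} {G : Matrix (Fin k) (Fin n) K}
    (hG : IsGeneratorMatrix G C) (Y : Set (Fin n)) :
    Module.finrank K (shortenedCode C Y) + rk (columnMatroid G) Yᶜ = Module.finrank K C := by
  classical
  set π : (Fin n → K) →ₗ[K] (↥(Yᶜ) → K) :=
    LinearMap.funLeft K K (Subtype.val : ↥(Yᶜ) → Fin n) with hπ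
  have h1 := LinearMap.finrank_range_add_finrank_ker (π.domRestrict C)
  have h2 : (LinearMap.ker (π.domRestrict C)).map C.subtype = shortenedCode C Y := by
    rw [LinearMap.ker_domRestrict, Submodule.map_comap_subtype]
    rfl
  have h3 : Module.finrank K (LinearMap.ker (π.domRestrict C)) =
      Module.finrank K (shortenedCode C Y) := by
    rw [← h2]
    exact (LinearEquiv.finrank_eq (Submodule.equivMapOfInjective _ C.injective_subtype _))
  have h4 : Module.finrank K (LinearMap.range (π.domRestrict C)) =
      rk (columnMatroid G) Yᶜ := by
    set G' : Matrix (Fin k) ↥(Yᶜ) K := G.submatrix id Subtype.val with hG'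
    have hrow : LinearMap.range (π.domRestrict C) = Submodule.span K (Set.range G'.row) := by
      rw [LinearMap.range_domRestrict, ← hG.2, Submodule.map_span, ← Set.range_comp]
      rfl
    have hcol : G.col '' Yᶜ = Set.range G'.col := by
      rw [Set.image_eq_range]
      rfl
    rw [hrow, ← Matrix.rank_eq_finrank_span_row, Matrix.rank_eq_finrank_span_cols,
      rk_columnMatroid, hcol]
  omega

lemma rk_columnMatroid_univ {C : Submodule K (Fin n → K)} {G : Matrix (Fin k) (Fin n) K}
    (hG : IsGeneratorMatrix G C) : rk (columnMatroid G) Set.univ = Module.finrank K C := by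
  have h := finrank_shortenedCode_add_rk hG ∅
  have h0 : shortenedCode C ∅ = ⊥ := by
    rw [eq_bot_iff]
    intro c hc
    rw [Submodule.mem_bot]
    ext i
    exact (mem_shortenedCode.1 hc).2 i (Set.notMem_empty i)
  rwa [h0, finrank_bot, zero_add, Set.compl_empty] at h

lemma nullity_dual_columnMatroid {C : Submodule K (Fin n → K)} {G : Matrix (Fin k) (Fin n) K}
    (hG : IsGeneratorMatrix G C) (Y : Set (Fin n)) :
    nullity (columnMatroid G)✶ Y = Module.finrank K (shortenedCode C Y) := by
  have h1 := finrank_shortenedCode_add_rk hG Y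
  rw [nullity_dual (columnMatroid_ground G), crk, columnMatroid_ground, rk_columnMatroid_univ hG]
  omega

lemma exists_codeWeight_eq {C : Submodule K (Fin n → K)} {G : Matrix (Fin k) (Fin n) K}
    (hG : IsGeneratorMatrix G C) {r : ℕ} (hr : r ≤ Module.finrank K C) :
    ∃ X, r ≤ nullity (columnMatroid G)✶ X ∧ codeWeight C r = X.ncard := by
  have hne : {m | ∃ D : Submodule K (Fin n → K),
      D ≤ C ∧ Module.finrank K D = r ∧ m = (codeSupport D).ncard}.Nonempty := by
    obtain ⟨b, hb⟩ := exists_linearIndependent_of_le_finrank hr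
    have hb' := hb.map' C.subtype C.ker_subtype
    refine ⟨_, Submodule.span K (Set.range (C.subtype ∘ b)), Submodule.span_le.2 ?_,
      (finrank_span_eq_card hb').trans (Fintype.card_fin r), rfl⟩
    rintro _ ⟨i, rfl⟩
    exact (b i).2
  obtain ⟨D, hDC, hDr, hD⟩ := Nat.sInf_mem hne
  -- An optimal `D` lies in the subcode supported in its own support, which therefore has dimension
  -- at least `r`.
  refine ⟨codeSupport D, ?_, hD⟩
  rw [nullity_dual_columnMatroid hG, ← hDr]
  exact Submodule.finrank_mono fun c hc => mem_shortenedCode.2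
    ⟨hDC hc, fun i hi => by_contra fun h => hi ⟨c, hc, h⟩⟩

lemma codeWeight_nullity_le {C : Submodule K (Fin n → K)} {G : Matrix (Fin k) (Fin n) K}
    (hG : IsGeneratorMatrix G C) (X : Set (Fin n)) :
    codeWeight C (nullity (columnMatroid G)✶ X) ≤ X.ncard := by
  have h : codeWeight C (nullity (columnMatroid G)✶ X) ≤
      (codeSupport (shortenedCode C X)).ncard :=
    Nat.sInf_le ⟨shortenedCode C X, inf_le_left, (nullity_dual_columnMatroid hG X).symm, rfl⟩
  refine h.trans (Set.ncard_le_ncard ?_)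
  rintro i ⟨c, hc, hci⟩
  by_contra hi
  exact hci ((mem_shortenedCode.1 hc).2 i hi)

end Codes

end MatroidWaldschmidt

theorem mainTheorem3 (L : Type u) [Field L] :
    (∀ (K : Type v) [Field K] (n k : ℕ) (C : Submodule K (Fin n → K))
        (G : Matrix (Fin k) (Fin n) K),
      1 ≤ k → Module.finrank K C = k → MatroidWaldschmidt.IsGeneratorMatrix G C →
      ∃ a : ℝ,
        MatroidWaldschmidt.IsWaldschmidtConstant
          (MatroidWaldschmidt.stanleyReisnerIdeal L
            (MatroidWaldschmidt.independenceComplex (MatroidWaldschmidt.columnMatroid G)✶)) a ∧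
        IsLeast {x : ℝ | ∃ r : ℕ, 1 ≤ r ∧ r ≤ k ∧
          x = (MatroidWaldschmidt.codeWeight C r : ℝ) / r} a) ∧
    (∀ (E : Type w) [Finite E] (M : Matroid E),
      M.E = Set.univ → 1 ≤ MatroidWaldschmidt.rk M✶ M✶.E →
      ∃ a : ℝ,
        MatroidWaldschmidt.IsWaldschmidtConstant
          (MatroidWaldschmidt.stanleyReisnerIdeal L
            (MatroidWaldschmidt.independenceComplex M)) a ∧
        IsLeast {x : ℝ | ∃ r : ℕ, 1 ≤ r ∧ r ≤ MatroidWaldschmidt.rk M✶ M✶.E ∧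
          x = (MatroidWaldschmidt.matroidWeight M r : ℝ) / r} a ∧
        IsLeast {x : ℝ | ∃ F : Set E, M✶.IsFlat F ∧ F ≠ M.E ∧
          x = ((M.E \ F).ncard : ℝ) / MatroidWaldschmidt.crk M✶ F} a) := by
  open MatroidWaldschmidt in
  constructor
  · intro K _ n k C G hk hCk hG
    have hM : (columnMatroid G)✶.E = Set.univ := rfl
    have htop : nullity (columnMatroid G)✶ Set.univ = k := by
      rw [nullity_univ hM, Matroid.dual_dual, columnMatroid_ground, rk_columnMatroid_univ hG, hCk]
    obtain ⟨Y, hY, hmin⟩ := exists_min_ncard_div_nullity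
      (M := (columnMatroid G)✶) (by omega)
    refine ⟨_, isWaldschmidtConstant_of_nullity hM hY (min_mul_nullity_le hmin), ?_⟩
    have := isLeast_weight_div (wt := codeWeight C) hY hmin
      (fun r _ hr => exists_codeWeight_eq hG (by omega)) (fun X _ => codeWeight_nullity_le hG X)
    rwa [htop] at this
  · intro E _ M hM hk
    rw [← nullity_univ hM] at hk ⊢
    obtain ⟨Y, hY, hmin⟩ := exists_min_ncard_div_nullity (M := M) (by omega)
    exact ⟨_, isWaldschmidtConstant_of_nullity hM hY (min_mul_nullity_le hmin),
      isLeast_weight_div hY hmin (fun r hr hrk => exists_matroidWeight_eq hM hr hrk)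
        (fun X hX => matroidWeight_nullity_le hM hX),
      isLeast_flat_ratio hM hY hmin⟩
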